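/- Let $K\ge 2$ and let the pairs $(i,j)$, $1\le i<j\le K$, index the coordinates of $\mathbb{R}^{\binom K2}$. Let $B$ be the $\binom K2\times K$ matrix whose entry in row $(s,t)$ and column $k$ is $\mathbb{I}(s=k)-\mathbb{I}(t=k)$. For $i<j<k$ let $c_{(i,j,k)}\in\mathbb{R}^{\binom K2}$ be the vector with entries $1$ at $(i,j)$, $1$ at $(j,k)$, $-1$ at $(i,k)$ and $0$ elsewhere. Let $C_s$ be the matrix with columns $c_{(i_1,j_1,k_1)},\dots,c_{(i_r,j_r,k_r)}$ for given triads $i_l<j_l<k_l$ ($r\ge 0$), and let $\mathcal S=\mathrm{span}(B,C_s)$ be the span of the columns of $B$ and $C_s$. Suppose that $Y_{ijk}=\nu_{ij}+\epsilon_{ijk}$ for $i<j$ and $1\le k\le n_{ij}$, where the errors $\epsilon_{ijk}$ are i.i.d. with mean $0$ and finite variance $\sigma^2>0$. Let $n=\sum_{i<j}n_{ij}$, let $D=\mathrm{diag}(n_{ij})$, let $\overline S$ be the vector of the averages $\overline S_{ij}=n_{ij}^{-1}\sum_{k=1}^{n_{ij}} Y_{ijk}$ (zero if $n_{ij}=0$),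 and let $\widehat\nu_s=B\widehat\mu+C_s\widehat\gamma_s$, where $(\widehat\mu,\widehat\gamma_s)$ is a minimizer of $\sum_{i<j}\sum_{k=1}^{n_{ij}}\big(Y_{ijk}-(B\mu+C_s\gamma)_{ij}\big)^2$ over all $(\mu,\gamma)\in\mathbb{R}^K\times\mathbb{R}^r$ with $\sum_i\mu_i=0$. Put $$R_{n,\mathcal S}=U_{n,\mathcal S}^\top U_{n,\mathcal S},\qquad U_{n,\mathcal S}=D^{1/2}(\overline S-\widehat\nu_s).$$ Suppose that, along a sequence of designs, $n_{ij}\to\infty$ and $n_{ij}/n\to\theta_{ij}$ with $\theta_{ij}>0$ for all $i<j$. Let $\Xi=\mathrm{diag}(\theta_{ij})$, and, with $^+$ denoting the Moore--Penrose inverse, let $$M=I-(B,C_s)\begin{pmatrix}B^\top\Xi B&B^\top\Xi C_s\\ C_s^\top\Xi B&C_s^\top\Xi C_s\end{pmatrix}^{+}\begin{pmatrix}B^\top\\ C_s^\top\end{pmatrix}\Xi,\qquad \Psi_{\mathcal S}=\sigma^2\,\Xi^{1/2}M\,\Xi^{+}M^\top\Xi^{1/2}.$$ **Theorem.** If $\nu\in\mathcal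 S$, then $$R_{n,\mathcal S}\Rightarrow\sum_{i=1}^t\lambda_iZ_i^2$$ in distribution, where $\lambda_1,\dots,\lambda_t$ are the nonzero eigenvalues of $\Psi_{\mathcal S}$, repeated according to multiplicity, $Z_1,\dots,Z_t$ are independent $\mathcal N(0,1)$ random variables, and $t=\mathrm{rank}(\Psi_{\mathcal S})$. If, moreover, the columns of $C_s$ are linearly independent, then $t=\binom K2-(K+r-1)$. -/

import Mathlib

open MeasureTheory ProbabilityTheory Filter Topology
open scoped Matrix

namespace PairedComparison

noncomputable section

/-! ### The Moore-Penrose inverse of a real matrix -/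

/-- The four Penrose equations: `X` is the Moore-Penrose inverse of the real matrix `A`. -/
structure IsMoorePenrose {m n : Type*} [Fintype m] [Fintype n]
    (A : Matrix m n ℝ) (X : Matrix n m ℝ) : Prop where
  mul_mul_self : A * X * A = A
  mul_mul_inv : X * A * X = X
  left_symm : (A * X)ᵀ = A * X
  right_symm : (X * A)ᵀ = X * A

theorem IsMoorePenrose.unique {m n : Type*} [Fintype m] [Fintype n]
    {A : Matrix m n ℝ} {X Y : Matrix n m ℝ}
    (hX : IsMoorePenrose A X) (hY : IsMoorePenrose A Y) : X = Y := by
  have h1 : A * X = A * Y := by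
    calc A * X = (A * X)ᵀ := hX.left_symm.symm
      _ = ((A * Y) * (A * X))ᵀ := by
        rw [← Matrix.mul_assoc (A * Y), hY.mul_mul_self]
      _ = (A * X) * (A * Y) := by
        rw [Matrix.transpose_mul, hX.left_symm, hY.left_symm]
      _ = A * Y := by rw [← Matrix.mul_assoc (A * X), hX.mul_mul_self]
  have h2 : X * A = Y * A := by
    calc X * A = (X * A)ᵀ := hX.right_symm.symm
      _ = ((X * A) * (Y * A))ᵀ := by
        rw [Matrix.mul_assoc X A (Y * A), ← Matrix.mul_assoc A Y A, hY.mul_mul_self]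
      _ = (Y * A) * (X * A) := by
        rw [Matrix.transpose_mul, hX.right_symm, hY.right_symm]
      _ = Y * A := by
        rw [Matrix.mul_assoc Y A (X * A), ← Matrix.mul_assoc A X A, hX.mul_mul_self]
  calc X = X * A * X := hX.mul_mul_inv.symm
    _ = Y * A * X := by rw [h2]
    _ = Y * (A * X) := Matrix.mul_assoc _ _ _
    _ = Y * (A * Y) := by rw [h1]
    _ = Y * A * Y := (Matrix.mul_assoc _ _ _).symm
    _ = Y := hY.mul_mul_inv

theorem exists_isMoorePenrose_of_isHermitian {n : Type*} [Fintype n]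
    {A : Matrix n n ℝ} (hA : A.IsHermitian) :
    ∃ X : Matrix n n ℝ, IsMoorePenrose A X ∧ Xᵀ = X := by
  classical
  obtain ⟨U, d, hU, hA'⟩ : ∃ (U : Matrix n n ℝ) (d : n → ℝ), Uᵀ * U = 1 ∧
      A = U * Matrix.diagonal d * Uᵀ := by
    refine ⟨(hA.eigenvectorUnitary : Matrix n n ℝ), hA.eigenvalues, ?_, ?_⟩
    · have := Matrix.mem_unitaryGroup_iff'.1 hA.eigenvectorUnitary.2
      simpa [Matrix.star_eq_conjTranspose] using this
    · have := hA.spectral_theorem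
      simpa [Unitary.conjStarAlgAut_apply, Matrix.star_eq_conjTranspose, Function.comp_def]
        using this
  have key : ∀ a b : n → ℝ, (U * Matrix.diagonal a * Uᵀ) * (U * Matrix.diagonal b * Uᵀ) =
      U * Matrix.diagonal (fun i => a i * b i) * Uᵀ := by
    intro a b
    calc (U * Matrix.diagonal a * Uᵀ) * (U * Matrix.diagonal b * Uᵀ)
        = U * Matrix.diagonal a * (Uᵀ * U) * Matrix.diagonal b * Uᵀ := by
          simp only [Matrix.mul_assoc]
      _ = _ := by rw [hU, Matrix.mul_one, Matrix.mul_assoc U, Matrix.diagonal_mul_diagonal]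
  have hs : ∀ a : n → ℝ, (U * Matrix.diagonal a * Uᵀ)ᵀ = U * Matrix.diagonal a * Uᵀ := by
    intro a
    simp [Matrix.transpose_mul, Matrix.mul_assoc]
  refine ⟨U * Matrix.diagonal (fun i => (d i)⁻¹) * Uᵀ, ⟨?_, ?_, ?_, ?_⟩, hs _⟩
  · rw [hA', key, key]
    congr 3
    funext i
    exact mul_inv_mul_cancel (d i)
  · rw [hA', key, key]
    congr 3
    funext i
    by_cases h : d i = 0 <;> simp [h]
  · rw [hA', key, hs]
  · rw [hA', key, hs]

theorem exists_isMoorePenrose {m n : Type*} [Fintype m] [Fintype n] (A : Matrix m n ℝ) :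
    ∃ X : Matrix n m ℝ, IsMoorePenrose A X := by
  have hS : (Aᵀ * A).IsHermitian := by
    simpa using Matrix.isHermitian_conjTranspose_mul_self A
  obtain ⟨G, hG, hGs⟩ := exists_isMoorePenrose_of_isHermitian hS
  have hmain : A * G * (Aᵀ * A) = A := by
    have h0 : (A * G * (Aᵀ * A) - A)ᵀ * (A * G * (Aᵀ * A) - A) = 0 := by
      have e : (A * G * (Aᵀ * A) - A)ᵀ = (Aᵀ * A) * G * Aᵀ - Aᵀ := by
        simp [Matrix.transpose_mul, hGs, Matrix.mul_assoc]
      have e2 : (Aᵀ * A) * G * Aᵀ * (A * G * (Aᵀ * A)) = Aᵀ * A := by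
        calc (Aᵀ * A) * G * Aᵀ * (A * G * (Aᵀ * A))
            = ((Aᵀ * A) * G * (Aᵀ * A)) * G * (Aᵀ * A) := by simp only [Matrix.mul_assoc]
          _ = Aᵀ * A := by rw [hG.mul_mul_self, hG.mul_mul_self]
      have e3 : (Aᵀ * A) * G * Aᵀ * A = Aᵀ * A := by
        rw [Matrix.mul_assoc _ Aᵀ A, hG.mul_mul_self]
      have e4 : Aᵀ * (A * G * (Aᵀ * A)) = Aᵀ * A := by
        calc Aᵀ * (A * G * (Aᵀ * A)) = (Aᵀ * A) * G * (Aᵀ * A) := by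
              simp only [Matrix.mul_assoc]
          _ = _ := hG.mul_mul_self
      rw [e, Matrix.sub_mul, Matrix.mul_sub, Matrix.mul_sub, e2, e3, e4]
      simp
    rw [← Matrix.conjTranspose_eq_transpose_of_trivial] at h0
    have := Matrix.conjTranspose_mul_self_eq_zero.1 h0
    exact sub_eq_zero.1 this
  refine ⟨G * Aᵀ, ⟨?_, ?_, ?_, ?_⟩⟩
  · calc A * (G * Aᵀ) * A = A * G * (Aᵀ * A) := by simp only [Matrix.mul_assoc]
      _ = A := hmain
  · calc G * Aᵀ * A * (G * Aᵀ) = (G * (Aᵀ * A) * G) * Aᵀ := by simp only [Matrix.mul_assoc]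
      _ = G * Aᵀ := by rw [hG.mul_mul_inv]
  · simp [Matrix.transpose_mul, hGs, Matrix.mul_assoc]
  · rw [Matrix.mul_assoc]
    exact hG.right_symm

/-- The Moore-Penrose inverse of a real matrix. -/
def pinv {m n : Type*} [Fintype m] [Fintype n] (A : Matrix m n ℝ) : Matrix n m ℝ :=
  Classical.choose (exists_isMoorePenrose A)

theorem isMoorePenrose_pinv {m n : Type*} [Fintype m] [Fintype n] (A : Matrix m n ℝ) :
    IsMoorePenrose A (pinv A) :=
  Classical.choose_spec (exists_isMoorePenrose A)

/-! ### Pairs, triads and the matrices `B`, `C`, `C_s` -/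

/-- The pairs `(i, j)` of items with `i < j`; they index the preference profile. -/
abbrev Pair (K : ℕ) : Type := {p : Fin K × Fin K // p.1 < p.2}

/-- The triads `(i, j, k)` of items with `i < j < k`. -/
abbrev Triad (K : ℕ) : Type := {x : Fin K × Fin K × Fin K // x.1 < x.2.1 ∧ x.2.1 < x.2.2}

/-- The matrix `B`, with entry `I(s = k) - I(t = k)` in row `(s, t)` and column `k`. -/
def linMat (K : ℕ) : Matrix (Pair K) (Fin K) ℝ :=
  Matrix.of fun p k => (if p.1.1 = k then 1 else 0) - (if p.1.2 = k then 1 else 0)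

/-- The matrix `C`: the column of the triad `(i, j, k)` has in row `(s, t)` the entry
`I((s,t) ∈ {(i,j),(j,k),(k,i)}) - I((s,t) ∈ {(j,i),(k,j),(i,k)})`. -/
def cycMat (K : ℕ) : Matrix (Pair K) (Triad K) ℝ :=
  Matrix.of fun p x =>
    let i := x.1.1
    let j := x.1.2.1
    let k := x.1.2.2
    (if p.1 = (i, j) ∨ p.1 = (j, k) ∨ p.1 = (k, i) then 1 else 0) -
      (if p.1 = (j, i) ∨ p.1 = (k, j) ∨ p.1 = (i, k) then 1 else 0)

/-- The matrix `C_s` whose columns are the columns of `C` of the listed triads. -/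
def subCyc {K r : ℕ} (tri : Fin r → Triad K) : Matrix (Pair K) (Fin r) ℝ :=
  (cycMat K).submatrix id tri

/-- The model `S = span(B, C_s)`. -/
def modelSpace {K r : ℕ} (tri : Fin r → Triad K) : Submodule ℝ (Pair K → ℝ) :=
  Submodule.span ℝ (Set.range (linMat K).col ∪ Set.range (subCyc tri).col)

/-- The profile `B μ + C_s γ`. -/
def profile {K r : ℕ} (tri : Fin r → Triad K) (μ : Fin K → ℝ) (γ : Fin r → ℝ) : Pair K → ℝ :=
  linMat K *ᵥ μ + subCyc tri *ᵥ γ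

/-! ### Least squares and the lack-of-fit statistic

In this section `N p` is the number of comparisons of the pair `p`, and the observed outcomes
of `p` are `Y p 0, …, Y p (N p - 1)`. -/

/-- The sum of squares of the data about the profile `v`. -/
def sumSq {K : ℕ} (N : Pair K → ℕ) (Y : Pair K → ℕ → ℝ) (v : Pair K → ℝ) : ℝ :=
  ∑ p, ∑ k ∈ Finset.range (N p), (Y p k - v p) ^ 2

/-- `(μ, γ)` is a least squares estimate in the model `S`: it minimizes the sum of squares
subject to `∑ i, μ i = 0`. -/
structure IsLSE {K r : ℕ} (tri : Fin r → Triad K) (N : Pair K → ℕ) (Y : Pair K → ℕ → ℝ)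
    (μ : Fin K → ℝ) (γ : Fin r → ℝ) : Prop where
  sum_eq_zero : ∑ i, μ i = 0
  le : ∀ (μ' : Fin K → ℝ) (γ' : Fin r → ℝ), ∑ i, μ' i = 0 →
    sumSq N Y (profile tri μ γ) ≤ sumSq N Y (profile tri μ' γ')

/-- The vector of the averages of the outcomes of each pair (zero if there are none). -/
def avg {K : ℕ} (N : Pair K → ℕ) (Y : Pair K → ℕ → ℝ) : Pair K → ℝ :=
  fun p => (∑ k ∈ Finset.range (N p), Y p k) / (N p : ℝ)

/-- `U = D^{1/2} (S̄ - ν̂)`, where `D` is the diagonal matrix of the numbers of comparisons. -/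
def residual {K : ℕ} (N : Pair K → ℕ) (Y : Pair K → ℕ → ℝ) (nuHat : Pair K → ℝ) : Pair K → ℝ :=
  Matrix.diagonal (fun p => √(N p : ℝ)) *ᵥ (avg N Y - nuHat)

/-- The lack-of-fit statistic `R = Uᵀ U`. -/
def lackOfFit {K : ℕ} (N : Pair K → ℕ) (Y : Pair K → ℕ → ℝ) (nuHat : Pair K → ℝ) : ℝ :=
  residual N Y nuHat ⬝ᵥ residual N Y nuHat

/-! ### The matrix `Ψ_S` -/

/-- The matrix
`M = I - (B, C_s) (BᵀΞB, BᵀΞC_s; C_sᵀΞB, C_sᵀΞC_s)⁺ (Bᵀ; C_sᵀ) Ξ` with `Ξ = diag(θ)`. -/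
def mMat {K r : ℕ} (tri : Fin r → Triad K) (θ : Pair K → ℝ) : Matrix (Pair K) (Pair K) ℝ :=
  let B := linMat K
  let C := subCyc tri
  let Ξ := Matrix.diagonal θ
  1 - Matrix.fromCols B C *
    pinv (Matrix.fromBlocks (Bᵀ * Ξ * B) (Bᵀ * Ξ * C) (Cᵀ * Ξ * B) (Cᵀ * Ξ * C)) *
    Matrix.fromRows Bᵀ Cᵀ * Ξ

/-- The matrix `Ψ_S = σ² Ξ^{1/2} M Ξ⁺ Mᵀ Ξ^{1/2}` with `Ξ = diag(θ)`, for `θ ≥ 0`. -/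
def psiMat {K r : ℕ} (tri : Fin r → Triad K) (θ : Pair K → ℝ) (σ : ℝ) :
    Matrix (Pair K) (Pair K) ℝ :=
  let Ξ := Matrix.diagonal θ
  let Ξsqrt := Matrix.diagonal fun p => √(θ p)
  σ ^ 2 • (Ξsqrt * mMat tri θ * pinv Ξ * (mMat tri θ)ᵀ * Ξsqrt)

end

end PairedComparison

open PairedComparison

namespace PairedComparison

/-! Let `W` be the vector of scaled error sums `N_p^{-1/2} ∑ ε_{pk}`, and `X = (B, C_s)`. The normal
equations say that `U` is orthogonal to the columns of `D^{1/2} X`. If `ν ∈ S`, then `U` differs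
from `W` by an element of that column space, so `R = Wᵀ (1 - P_n) W` with `P_n` the projection onto
it (`IsLSE.lackOfFit_eq`).

`W` tends to `σ` times a standard Gaussian vector (`tendstoInDistribution_toLp_sum`), and `P_n`
tends to the projection `P` onto the column space of `Ξ^{1/2} X` (`tendsto_colProj_design`). By
Slutsky, `R` tends to a Gaussian quadratic form with matrix `σ² (1 - P)`, which is `Ψ_S`
(`psiMat_eq`). Diagonalizing it gives the weighted sum of squares.

The number of weights is the rank of `1 - P`. It is found from the rank of `X`: the columns of `B`
and `C_s` are orthogonal, and `B` kills exactly the constants. -/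

/-! ### Central limit theorem for independent samples -/

theorem charFun_map_toLp_sum {Ω ι κ : Type*} [MeasurableSpace Ω] {P : Measure Ω}
    [Fintype ι] {X : ι → κ → Ω → ℝ}
    (hX : ∀ i k, AEMeasurable (X i k) P) (hindep : iIndepFun (fun a : ι × κ => X a.1 a.2) P)
    (s : ι → Finset κ) (c : ι → ℝ) (t : EuclideanSpace ℝ ι) :
    charFun (P.map fun ω => WithLp.toLp 2 fun i => c i * ∑ k ∈ s i, X i k ω) t =
      ∏ i, charFun (P.map fun ω => c i * ∑ k ∈ s i, X i k ω) (t i) := by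
  classical
  have hp := hindep.isProbabilityMeasure
  have hm : ∀ i, AEMeasurable (fun ω => ∑ k ∈ s i, X i k ω) P := fun i =>
    Finset.aemeasurable_fun_sum _ fun k _ => hX i k
  have hi : iIndepFun (fun (a : Σ _ : ι, κ) ω => (t a.1 * c a.1) * X a.1 a.2 ω) P :=
    (hindep.precomp (g := fun a : Σ _ : ι, κ => (a.1, a.2))
      (by rintro ⟨a, b⟩ ⟨c, d⟩ h; simp_all)).comp (fun a x => (t a.1 * c a.1) * x)
      (fun a => by fun_prop)
  -- The value at `t` is the characteristic function at `1` of one scalar sum of independent terms;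
  -- it factors over all terms and is then regrouped by `i`.
  have h1 : charFun (P.map fun ω => WithLp.toLp 2 fun i => c i * ∑ k ∈ s i, X i k ω) t =
      charFun (P.map fun ω => ∑ a ∈ Finset.univ.sigma s, (t a.1 * c a.1) * X a.1 a.2 ω) 1 := by
    rw [charFun_apply, charFun_apply, integral_map (by fun_prop) (by fun_prop),
      integral_map (Finset.aemeasurable_fun_sum _ fun a _ => (hX a.1 a.2).const_mul _)
        (by fun_prop)]
    congr 1
    ext ω
    congr 3
    simp only [PiLp.inner_apply, Finset.sum_sigma, RCLike.inner_apply, conj_trivial, one_mul]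
    refine Finset.sum_congr rfl fun i _ => ?_
    rw [← Finset.mul_sum]
    ring
  rw [h1, (hi.restrict (Finset.univ.sigma s)).charFun_map_fun_finsetSum_eq_prod
    (fun a _ => (hX a.1 a.2).const_mul _), Finset.prod_apply, Finset.prod_sigma]
  refine Finset.prod_congr rfl fun i _ => ?_
  have hi' : iIndepFun (X i) P := hindep.precomp (g := fun k => (i, k)) (by intro a b h; simp_all)
  rw [charFun_map_mul_comp,
    (hi'.restrict _).charFun_map_fun_finsetSum_eq_prod (fun k _ => hX i k), Finset.prod_apply]
  · refine Finset.prod_congr rfl fun k _ => ?_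
    rw [charFun_map_mul_comp (hX i k)]
    congr 1
    ring
  · exact hm i

/-- The multivariate central limit theorem for independent samples whose sizes tend to infinity. -/
theorem tendstoInDistribution_toLp_sum {Ω ι : Type*} [MeasurableSpace Ω] {P : Measure Ω}
    [IsProbabilityMeasure P] [Fintype ι] {ε : ι → ℕ → Ω → ℝ} {σ : ℝ}
    (hindep : iIndepFun (fun a : ι × ℕ => ε a.1 a.2) P)
    (hident : ∀ p k l, IdentDistrib (ε p k) (ε p l) P P)
    (hL2 : ∀ p k, MemLp (ε p k) 2 P)
    (hmean : ∀ p k, ∫ ω, ε p k ω ∂P = 0)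
    (hvar : ∀ p k, variance (ε p k) P = σ ^ 2)
    {N : ℕ → ι → ℕ} (hN : ∀ p, Tendsto (fun m => N m p) atTop atTop) :
    TendstoInDistribution
      (fun m ω => (WithLp.toLp 2 fun p =>
        (√(N m p : ℝ))⁻¹ * ∑ k ∈ Finset.range (N m p), ε p k ω : EuclideanSpace ℝ ι))
      atTop (fun x => σ • x) (fun _ => P) (stdGaussian (EuclideanSpace ℝ ι)) := by
  have hm : ∀ p k, AEMeasurable (ε p k) P := fun p k => (hL2 p k).1.aemeasurable
  have hms : ∀ m p, AEMeasurable (fun ω => ∑ k ∈ Finset.range (N m p), ε p k ω) P := fun m i =>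
    Finset.aemeasurable_fun_sum _ fun k _ => hm i k
  refine ⟨fun m => by fun_prop, by fun_prop, ?_⟩
  refine ProbabilityMeasure.tendsto_iff_tendsto_charFun.2 fun t ↦ ?_
  -- The joint characteristic function is a product over `p`, so the one-dimensional theorem along
  -- each `N m p → ∞` suffices, whatever the relative rates.
  have hcoord : ∀ p, Tendsto (fun m => charFun (P.map fun ω =>
      (√(N m p : ℝ))⁻¹ * ∑ k ∈ Finset.range (N m p), ε p k ω) (t p)) atTop
      (𝓝 (charFun (gaussianReal 0 (σ ^ 2).toNNReal) (t p))) := by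
    intro p
    have h := tendstoInDistribution_inv_sqrt_mul_sum_sub (X := ε p) (P := P)
      (P' := gaussianReal 0 (σ ^ 2).toNNReal) (Y := id)
      (by rw [hvar]; exact HasLaw.id) (hL2 p 0)
      (hindep.precomp (g := fun k => (p, k)) (by intro a b h; simp_all))
      (fun i => hident p i 0)
    have h2 := (ProbabilityMeasure.tendsto_iff_tendsto_charFun.1 h.tendsto (t p)).comp (hN p)
    simpa [Function.comp_def, hmean] using h2
  have hlim : charFun ((stdGaussian (EuclideanSpace ℝ ι)).map fun x => σ • x) t =
      ∏ p, charFun (gaussianReal 0 (σ ^ 2).toNNReal) (t p) := by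
    rw [charFun_map_smul, charFun_stdGaussian]
    simp_rw [charFun_gaussianReal]
    rw [← Complex.exp_sum, ← Complex.ofReal_pow, EuclideanSpace.real_norm_sq_eq]
    congr 1
    simp only [Complex.ofReal_zero, mul_zero, zero_mul, zero_sub, Real.coe_toNNReal _ (sq_nonneg σ),
      PiLp.smul_apply, smul_eq_mul, mul_pow, Finset.sum_neg_distrib, neg_div, Finset.sum_div,
      Complex.ofReal_sum, Complex.ofReal_mul, Complex.ofReal_pow]
  simp only [ProbabilityMeasure.coe_mk, hlim]
  simp_rw [charFun_map_toLp_sum hm hindep (fun p => Finset.range (N _ p))]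
  exact tendsto_finsetProd _ fun p _ => hcoord p

/-! ### Quadratic forms in Gaussian vectors -/

/-- The law of a quadratic form in a standard Gaussian vector. -/
theorem map_quadraticForm_stdGaussian {n : Type*} [Fintype n] [DecidableEq n]
    {A : Matrix n n ℝ} (hA : A.IsHermitian) :
    (stdGaussian (EuclideanSpace ℝ n)).map (fun x => x.ofLp ⬝ᵥ A *ᵥ x.ofLp) =
      (Measure.pi fun _ : n => gaussianReal 0 1).map
        (fun x => ∑ i, hA.eigenvalues i * x i ^ 2) := by
  -- Rotation invariance: the coordinates in an eigenbasis of `A` are again independent standard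
  -- normals.
  rw [stdGaussian_eq_map_pi_orthonormalBasis hA.eigenvectorBasis,
    Measure.map_map (Continuous.measurable (by fun_prop)) (by fun_prop)]
  congr 1
  ext x
  have ho : ∀ i j, (hA.eigenvectorBasis i).ofLp ⬝ᵥ (hA.eigenvectorBasis j).ofLp =
      if i = j then 1 else 0 := by
    intro i j
    have := orthonormal_iff_ite.1 hA.eigenvectorBasis.orthonormal i j
    rw [← this]
    simp [PiLp.inner_apply, dotProduct, mul_comm]
  simp only [Function.comp_apply, WithLp.ofLp_sum, WithLp.ofLp_smul, Matrix.mulVec_sum,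
    Matrix.mulVec_smul, hA.mulVec_eigenvectorBasis, sum_dotProduct, dotProduct_sum,
    smul_dotProduct, dotProduct_smul, ho, smul_eq_mul]
  simp
  refine Finset.sum_congr rfl fun i _ => ?_
  ring

/-- Equal multisets of values mean equally large fibres over each value; bijections between the
fibres glue together. -/
theorem exists_equiv_of_map_univ_eq {α β γ : Type*} [Fintype α] [Fintype β]
    {f : α → γ} {g : β → γ}
    (h : Multiset.map f Finset.univ.val = Multiset.map g Finset.univ.val) :
    ∃ e : α ≃ β, ∀ a, f a = g (e a) := by
  classical
  have hc : ∀ c, Fintype.card {a // f a = c} = Fintype.card {b // g b = c} := by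
    intro c
    have := congrArg (Multiset.count c) h
    rw [Multiset.count_map, Multiset.count_map, ← Finset.filter_val, ← Finset.filter_val,
      Finset.card_val, Finset.card_val] at this
    simpa only [Fintype.card_subtype, eq_comm] using this
  let e := (Equiv.sigmaFiberEquiv f).symm.trans
    ((Equiv.sigmaCongrRight fun c => Fintype.equivOfCardEq (hc c)).trans (Equiv.sigmaFiberEquiv g))
  exact ⟨e, fun a => ((Fintype.equivOfCardEq (hc (f a)) ⟨a, rfl⟩).2).symm⟩

/-- The roots of the characteristic polynomial are the spectral eigenvalues with multiplicity. The
bijection serves both to reindex the weights and to count them. -/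
theorem exists_equiv_nonzero_eigenvalues {n : Type*} [Fintype n] [DecidableEq n]
    {A : Matrix n n ℝ} (hA : A.IsHermitian) {t : ℕ} {lam : Fin t → ℝ}
    (hlam : Multiset.map lam Finset.univ.val = A.charpoly.roots.filter (fun x => x ≠ 0)) :
    ∃ e : Fin t ≃ {i // hA.eigenvalues i ≠ 0}, ∀ i, lam i = hA.eigenvalues (e i) := by
  refine exists_equiv_of_map_univ_eq (f := lam)
    (g := fun i : {i // hA.eigenvalues i ≠ 0} => hA.eigenvalues i) ?_
  rw [hlam, hA.roots_charpoly_eq_eigenvalues, Multiset.filter_map, ← Finset.filter_val]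
  exact (Finset.univ_val_map_subtype_restrict hA.eigenvalues _).symm

/-- A weighted sum of squares of independent standard Gaussians has the law of a quadratic form
whose nonzero eigenvalues are the weights. -/
theorem map_sum_sq_eq_map_quadraticForm {n : Type*} [Fintype n] [DecidableEq n]
    {A : Matrix n n ℝ} (hA : A.IsHermitian) {t : ℕ} {lam : Fin t → ℝ}
    (hlam : Multiset.map lam Finset.univ.val = A.charpoly.roots.filter (fun x => x ≠ 0))
    {Ω' : Type*} [MeasurableSpace Ω'] {P' : Measure Ω'}
    {Z : Fin t → Ω' → ℝ} (hZindep : iIndepFun Z P')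
    (hZlaw : ∀ i, HasLaw (Z i) (gaussianReal 0 1) P') :
    P'.map (fun ω' => ∑ i, lam i * Z i ω' ^ 2) =
      (stdGaussian (EuclideanSpace ℝ n)).map (fun x => x.ofLp ⬝ᵥ A *ᵥ x.ofLp) := by
  obtain ⟨e, he⟩ := exists_equiv_nonzero_eigenvalues hA hlam
  have hZ := hZindep.hasLaw_pi hZlaw
  -- The selected coordinates are distinct because `e` is injective, so they remain independent.
  have hpi : (Measure.pi fun _ : n => gaussianReal 0 1).map (fun x (i : Fin t) => x (e i)) =
      Measure.pi fun _ : Fin t => gaussianReal 0 1 := by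
    have h1 : iIndepFun (fun (i : n) (x : n → ℝ) => x i)
        (Measure.pi fun _ : n => gaussianReal 0 1) :=
      iIndepFun_pi (X := fun _ x => x) (fun _ => aemeasurable_id)
    have h2 := h1.precomp (g := fun i : Fin t => (e i : n))
      (Subtype.val_injective.comp e.injective)
    refine (h2.hasLaw_pi (μ := fun _ => gaussianReal 0 1) fun i =>
      ⟨(measurable_pi_apply (e i : n)).aemeasurable, ?_⟩).map_eq
    exact (measurePreserving_eval (fun _ : n => gaussianReal 0 1) (e i : n)).map_eq
  rw [map_quadraticForm_stdGaussian hA]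
  have h3 : (fun x : n → ℝ => ∑ i, hA.eigenvalues i * x i ^ 2) =
      (fun y : Fin t → ℝ => ∑ i, lam i * y i ^ 2) ∘ fun x i => x (e i) := by
    ext x
    simp only [Function.comp_apply, he]
    rw [Equiv.sum_comp e (fun j => hA.eigenvalues j * x j ^ 2)]
    rw [← Fintype.sum_subtype_add_sum_subtype (fun i => hA.eigenvalues i ≠ 0), add_eq_left]
    refine Finset.sum_eq_zero fun i _ => ?_
    rw [not_not.1 i.2, zero_mul]
  have h4 : Measurable fun y : Fin t → ℝ => ∑ i, lam i * y i ^ 2 := by fun_prop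
  rw [h3, ← Measure.map_map h4 (by fun_prop), hpi, ← hZ.map_eq,
    AEMeasurable.map_map_of_aemeasurable h4.aemeasurable hZ.aemeasurable]
  rfl

/-! ### Orthogonal projections onto column spaces -/

/-- The matrix of the orthogonal projection onto the column space of `A`. -/
noncomputable def colProj {m n : Type*} [Fintype m] [Fintype n] (A : Matrix m n ℝ) :
    Matrix m m ℝ :=
  A * pinv (Aᵀ * A) * Aᵀ

theorem IsMoorePenrose.transpose {m n : Type*} [Fintype m] [Fintype n]
    {A : Matrix m n ℝ} {X : Matrix n m ℝ} (h : IsMoorePenrose A X) : IsMoorePenrose Aᵀ Xᵀ where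
  mul_mul_self := by
    rw [← Matrix.transpose_mul, ← Matrix.transpose_mul, ← Matrix.mul_assoc, h.mul_mul_self]
  mul_mul_inv := by
    rw [← Matrix.transpose_mul, ← Matrix.transpose_mul, ← Matrix.mul_assoc, h.mul_mul_inv]
  left_symm := by rw [← Matrix.transpose_mul, h.right_symm, h.right_symm]
  right_symm := by rw [← Matrix.transpose_mul, h.left_symm, h.left_symm]

theorem pinv_transpose {m n : Type*} [Fintype m] [Fintype n] (A : Matrix m n ℝ) :
    pinv Aᵀ = (pinv A)ᵀ :=
  (isMoorePenrose_pinv Aᵀ).unique (isMoorePenrose_pinv A).transpose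

theorem pinv_eq_inv {n : Type*} [Fintype n] [DecidableEq n] {A : Matrix n n ℝ}
    (hA : IsUnit A.det) : pinv A = A⁻¹ :=
  (isMoorePenrose_pinv A).unique
    { mul_mul_self := by rw [Matrix.mul_nonsing_inv _ hA, Matrix.one_mul]
      mul_mul_inv := by rw [Matrix.nonsing_inv_mul _ hA, Matrix.one_mul]
      left_symm := by rw [Matrix.mul_nonsing_inv _ hA, Matrix.transpose_one]
      right_symm := by rw [Matrix.nonsing_inv_mul _ hA, Matrix.transpose_one] }

/-- Every real matrix has the column space of a matrix with linearly independent columns. -/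
theorem exists_injective_factor {m n : Type*} [Fintype n] (X : Matrix m n ℝ) :
    ∃ (d : ℕ) (E : Matrix m (Fin d) ℝ) (H : Matrix (Fin d) n ℝ) (F : Matrix n (Fin d) ℝ),
      X = E * H ∧ E = X * F ∧ Function.Injective E.mulVec := by
  classical
  -- The columns of `E` are a basis of the column space, `H` holds the coordinates of the columns of
  -- `X` in it, and `F` holds preimages of the basis vectors.
  let b := Module.finBasis ℝ (LinearMap.range X.mulVecLin)
  have hF : ∀ j, ∃ c, X *ᵥ c = (b j : m → ℝ) := fun j => (b j).2
  choose F hF using hF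
  refine ⟨_, Matrix.of fun i j => (b j : m → ℝ) i,
    Matrix.of fun j k => b.repr ⟨X.mulVecLin (Pi.single k 1), ⟨_, rfl⟩⟩ j,
    Matrix.of fun k j => F j k, ?_, ?_, ?_⟩
  · ext i k
    have := congrArg (fun v : LinearMap.range X.mulVecLin => (v : m → ℝ) i)
      (b.sum_repr ⟨X.mulVecLin (Pi.single k 1), ⟨_, rfl⟩⟩)
    simp only [Submodule.coe_sum, Submodule.coe_smul, Finset.sum_apply, Pi.smul_apply,
      Matrix.mulVecLin_apply, Matrix.mulVec_single_one, smul_eq_mul, Matrix.col_apply] at this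
    rw [← this, Matrix.mul_apply]
    refine Finset.sum_congr rfl fun j _ => ?_
    simp [mul_comm]
  · ext i j
    rw [Matrix.of_apply, ← hF j]
    rfl
  · have hli : LinearIndependent ℝ fun j => (b j : m → ℝ) :=
      b.linearIndependent.map' (Submodule.subtype _) (Submodule.ker_subtype _)
    rw [Matrix.mulVec_injective_iff]
    exact hli

section colProj

variable {m n n' : Type*} [Fintype m] [Fintype n] [Fintype n']

theorem colProj_transpose (A : Matrix m n ℝ) : (colProj A)ᵀ = colProj A := by
  have h : (pinv (Aᵀ * A))ᵀ = pinv (Aᵀ * A) := by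
    rw [← pinv_transpose, Matrix.transpose_mul, Matrix.transpose_transpose]
  simp [colProj, Matrix.transpose_mul, h, Matrix.mul_assoc]

/-- By the first Penrose equation `Aᵀ` kills the defect `colProj A * A - A`, whose transpose has
`Aᵀ` as right factor. So the Gram matrix of the defect vanishes. -/
theorem colProj_mul_self (A : Matrix m n ℝ) : colProj A * A = A := by
  classical
  have h0 : Aᵀ * (colProj A * A - A) = 0 := by
    rw [Matrix.mul_sub, sub_eq_zero]
    calc Aᵀ * (colProj A * A) = Aᵀ * A * pinv (Aᵀ * A) * (Aᵀ * A) := by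
          simp only [colProj, Matrix.mul_assoc]
      _ = Aᵀ * A := (isMoorePenrose_pinv _).mul_mul_self
  have h1 : (colProj A * A - A)ᵀ * (colProj A * A - A) = 0 := by
    have : (colProj A * A - A)ᵀ = (Aᵀ * A * pinv (Aᵀ * A) - 1) * Aᵀ := by
      rw [Matrix.transpose_sub, Matrix.transpose_mul, colProj_transpose, Matrix.sub_mul,
        Matrix.one_mul]
      simp only [colProj, Matrix.mul_assoc]
    rw [this, Matrix.mul_assoc, h0, Matrix.mul_zero]
  rw [← Matrix.conjTranspose_eq_transpose_of_trivial] at h1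
  exact sub_eq_zero.1 (Matrix.conjTranspose_mul_self_eq_zero.1 h1)

theorem colProj_mul_colProj_of_eq_mul {A : Matrix m n ℝ} {A' : Matrix m n' ℝ}
    {H : Matrix n' n ℝ} (h : A = A' * H) : colProj A' * colProj A = colProj A := by
  have : colProj A' * A = A := by rw [h, ← Matrix.mul_assoc, colProj_mul_self]
  rw [show colProj A = A * pinv (Aᵀ * A) * Aᵀ from rfl, ← Matrix.mul_assoc, ← Matrix.mul_assoc,
    this]

theorem colProj_mul_colProj (A : Matrix m n ℝ) : colProj A * colProj A = colProj A := by
  classical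
  exact colProj_mul_colProj_of_eq_mul (Matrix.mul_one A).symm

/-- The hypotheses say that the column spaces coincide. Each projection then fixes the other, and
symmetry makes them equal. -/
theorem colProj_congr {A : Matrix m n ℝ} {A' : Matrix m n' ℝ}
    {H : Matrix n' n ℝ} {F : Matrix n n' ℝ} (h : A = A' * H) (h' : A' = A * F) :
    colProj A = colProj A' := by
  have h1 := colProj_mul_colProj_of_eq_mul h
  have h2 := congrArg Matrix.transpose (colProj_mul_colProj_of_eq_mul h')
  rw [Matrix.transpose_mul, colProj_transpose, colProj_transpose] at h2
  rw [← h1, h2]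

theorem colProj_mulVec_eq_zero {A : Matrix m n ℝ} {u : m → ℝ} (h : Aᵀ *ᵥ u = 0) :
    colProj A *ᵥ u = 0 := by
  rw [colProj, ← Matrix.mulVec_mulVec, h, Matrix.mulVec_zero]

theorem one_sub_colProj_transpose [DecidableEq m] (A : Matrix m n ℝ) :
    (1 - colProj A)ᵀ = 1 - colProj A := by
  rw [Matrix.transpose_sub, Matrix.transpose_one, colProj_transpose]

theorem one_sub_colProj_mul [DecidableEq m] (A : Matrix m n ℝ) :
    (1 - colProj A) * (1 - colProj A) = 1 - colProj A := by
  rw [Matrix.sub_mul, Matrix.mul_sub, Matrix.mul_sub, colProj_mul_colProj]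
  simp

/-- The residual of the orthogonal projection of `w` onto the column space of `A`. -/
theorem dotProduct_self_of_orthogonal [DecidableEq m] {A : Matrix m n ℝ} {u w : m → ℝ} {c : n → ℝ}
    (hu : u = w - A *ᵥ c) (h : Aᵀ *ᵥ u = 0) : u ⬝ᵥ u = w ⬝ᵥ (1 - colProj A) *ᵥ w := by
  have h1 : u = (1 - colProj A) *ᵥ w := by
    have e1 : (1 - colProj A) *ᵥ u = u := by
      rw [Matrix.sub_mulVec, Matrix.one_mulVec, colProj_mulVec_eq_zero h, sub_zero]
    have e2 : (1 - colProj A) *ᵥ (A *ᵥ c) = 0 := by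
      rw [Matrix.mulVec_mulVec, Matrix.sub_mul, colProj_mul_self, Matrix.one_mul, sub_self,
        Matrix.zero_mulVec]
    rw [← e1, hu, Matrix.mulVec_sub, e2, sub_zero]
  rw [h1, Matrix.dotProduct_mulVec, ← Matrix.mulVec_transpose, one_sub_colProj_transpose,
    Matrix.mulVec_mulVec, one_sub_colProj_mul, dotProduct_comm]

/-- The kernel of `1 - colProj A` is the column space of `A`; rank-nullity does the rest. -/
theorem rank_one_sub_colProj [DecidableEq m] (A : Matrix m n ℝ) :
    (1 - colProj A).rank + A.rank = Fintype.card m := by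
  have hker : LinearMap.ker (1 - colProj A).mulVecLin = LinearMap.range A.mulVecLin := by
    ext x
    rw [LinearMap.mem_ker, LinearMap.mem_range]
    constructor
    · intro h
      refine ⟨(pinv (Aᵀ * A) * Aᵀ) *ᵥ x, ?_⟩
      rw [Matrix.mulVecLin_apply, Matrix.sub_mulVec, Matrix.one_mulVec, sub_eq_zero] at h
      rw [Matrix.mulVecLin_apply, Matrix.mulVec_mulVec, ← Matrix.mul_assoc]
      exact h.symm
    · rintro ⟨c, rfl⟩
      rw [Matrix.mulVecLin_apply, Matrix.mulVecLin_apply, Matrix.mulVec_mulVec, Matrix.sub_mul,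
        colProj_mul_self, Matrix.one_mul, sub_self, Matrix.zero_mulVec]
  have := LinearMap.finrank_range_add_finrank_ker (1 - colProj A).mulVecLin
  rw [hker, Module.finrank_fintype_fun_eq_card] at this
  exact this

/-- The projection onto the column space of `diag(a) X` is continuous in `a` where all the entries
of `a` are nonzero. -/
theorem tendsto_colProj_diagonal_mul [DecidableEq m] (X : Matrix m n ℝ) {ι : Type*} {l : Filter ι}
    {a : ι → m → ℝ} {a₀ : m → ℝ} (ha : Tendsto a l (𝓝 a₀)) (ha₀ : ∀ i, a₀ i ≠ 0) :
    Tendsto (fun k => colProj (Matrix.diagonal (a k) * X)) l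
      (𝓝 (colProj (Matrix.diagonal a₀ * X))) := by
  -- The pseudoinverse is not continuous in general. Passing to `E` with independent columns leaves
  -- the projection unchanged and makes the Gram matrix invertible at `a₀`, hence nearby, where the
  -- ordinary inverse is continuous.
  obtain ⟨d, E, H, F, h1, h2, hE⟩ := exists_injective_factor X
  have hc : ∀ a : m → ℝ, colProj (Matrix.diagonal a * X) = colProj (Matrix.diagonal a * E) := by
    intro a
    refine colProj_congr (H := H) (F := F) ?_ ?_
    · rw [Matrix.mul_assoc, ← h1]
    · rw [Matrix.mul_assoc, ← h2]
  simp_rw [hc]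
  let G : (m → ℝ) → Matrix (Fin d) (Fin d) ℝ := fun a =>
    (Matrix.diagonal a * E)ᵀ * (Matrix.diagonal a * E)
  have hG : Continuous G := by fun_prop
  have hdet : (G a₀).det ≠ 0 := by
    have hinj : Function.Injective (Matrix.diagonal a₀ * E).mulVec := by
      intro x y hxy
      apply hE
      ext i
      have := congrFun hxy i
      simp only [← Matrix.mulVec_mulVec, Matrix.mulVec_diagonal] at this
      exact mul_left_cancel₀ (ha₀ i) this
    have hp := Matrix.PosDef.conjTranspose_mul_self _ hinj
    exact hp.det_pos.ne'
  have hd : ∀ᶠ k in l, (G (a k)).det ≠ 0 :=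
    ((hG.matrix_det.tendsto a₀).comp ha).eventually_ne hdet
  have hinv : Tendsto (fun k => (G (a k))⁻¹) l (𝓝 (G a₀)⁻¹) := by
    simp_rw [Matrix.inv_def, Ring.inverse_eq_inv']
    exact (((hG.matrix_det.tendsto a₀).comp ha).inv₀ hdet).smul
      ((hG.matrix_adjugate.tendsto a₀).comp ha)
  have hlim := ((by fun_prop : Continuous fun p : (m → ℝ) × Matrix (Fin d) (Fin d) ℝ =>
    Matrix.diagonal p.1 * E * p.2 * (Matrix.diagonal p.1 * E)ᵀ).tendsto
      (a₀, (G a₀)⁻¹)).comp (ha.prodMk_nhds hinv)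
  have e0 : colProj (Matrix.diagonal a₀ * E) =
      Matrix.diagonal a₀ * E * (G a₀)⁻¹ * (Matrix.diagonal a₀ * E)ᵀ := by
    rw [colProj, pinv_eq_inv (isUnit_iff_ne_zero.2 hdet)]
  rw [e0]
  refine hlim.congr' ?_
  filter_upwards [hd] with k hk
  rw [colProj, pinv_eq_inv (isUnit_iff_ne_zero.2 hk)]
  rfl

end colProj

/-! ### The design matrix and `Ψ_S` -/

variable {K r : ℕ}

/-- The matrix `(B, C_s)`. -/
noncomputable def designMat (tri : Fin r → Triad K) : Matrix (Pair K) (Fin K ⊕ Fin r) ℝ :=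
  Matrix.fromCols (linMat K) (subCyc tri)

theorem designMat_mulVec (tri : Fin r → Triad K) (c : Fin K ⊕ Fin r → ℝ) :
    designMat tri *ᵥ c = profile tri (c ∘ Sum.inl) (c ∘ Sum.inr) := by
  rw [designMat, Matrix.fromCols_mulVec]
  rfl

theorem exists_designMat_mulVec_eq {tri : Fin r → Triad K} {ν : Pair K → ℝ}
    (hν : ν ∈ modelSpace tri) : ∃ c, designMat tri *ᵥ c = ν := by
  have h : modelSpace tri = LinearMap.range (designMat tri).mulVecLin := by
    rw [Matrix.range_mulVecLin, modelSpace]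
    congr 1
    ext v
    simp only [Set.mem_union, Set.mem_range, Sum.exists]
    rfl
  rw [h] at hν
  exact hν

/-- `Ψ_S` is `σ²` times the projection onto the orthogonal complement of the column space of
`Ξ^{1/2} (B, C_s)`. -/
theorem psiMat_eq (tri : Fin r → Triad K) {θ : Pair K → ℝ} (hθ : ∀ p, 0 < θ p) (σ : ℝ) :
    psiMat tri θ σ =
      σ ^ 2 • (1 - colProj (Matrix.diagonal (fun p => √(θ p)) * designMat tri)) := by
  set D : Matrix (Pair K) (Pair K) ℝ := Matrix.diagonal fun p => √(θ p) with hD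
  set Ξ : Matrix (Pair K) (Pair K) ℝ := Matrix.diagonal θ with hΞ
  set X := designMat tri with hX
  have hDt : Dᵀ = D := Matrix.diagonal_transpose _
  have hDD : D * D = Ξ := by
    rw [hD, Matrix.diagonal_mul_diagonal]
    congr 1
    ext p
    exact Real.mul_self_sqrt (hθ p).le
  have hdet : IsUnit Ξ.det := by
    rw [hΞ, Matrix.det_diagonal, isUnit_iff_ne_zero, Finset.prod_ne_zero_iff]
    exact fun p _ => (hθ p).ne'
  have hDdet : IsUnit D.det := by
    rw [← hDD, Matrix.det_mul] at hdet
    exact isUnit_of_mul_isUnit_left hdet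
  have hinv : D * pinv Ξ * D = 1 := by
    rw [pinv_eq_inv hdet, ← hDD, Matrix.mul_inv_rev, ← Matrix.mul_assoc,
      Matrix.mul_nonsing_inv _ hDdet, Matrix.one_mul, Matrix.nonsing_inv_mul _ hDdet]
  have hblock : Matrix.fromBlocks ((linMat K)ᵀ * Ξ * linMat K) ((linMat K)ᵀ * Ξ * subCyc tri)
      ((subCyc tri)ᵀ * Ξ * linMat K) ((subCyc tri)ᵀ * Ξ * subCyc tri) = (D * X)ᵀ * (D * X) := by
    rw [Matrix.transpose_mul, hDt, Matrix.mul_assoc Xᵀ, ← Matrix.mul_assoc D D X, hDD, hX, designMat,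
      Matrix.transpose_fromCols, Matrix.mul_fromCols, Matrix.fromRows_mul_fromCols]
    simp only [Matrix.mul_assoc]
  -- `M` is an oblique projection; conjugation by `D = Ξ^{1/2}` turns it into the orthogonal one,
  -- because the block matrix is the Gram matrix of `D * X`.
  have hM : D * mMat tri θ = (1 - colProj (D * X)) * D := by
    have : mMat tri θ = 1 - X * pinv ((D * X)ᵀ * (D * X)) * Xᵀ * Ξ := by
      rw [mMat, ← hΞ, hblock, ← Matrix.transpose_fromCols]
      rfl
    rw [this, Matrix.mul_sub, Matrix.sub_mul, Matrix.mul_one, Matrix.one_mul, ← hDD, colProj,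
      Matrix.transpose_mul D X, hDt]
    simp only [Matrix.mul_assoc]
  have hMt : (mMat tri θ)ᵀ * D = D * (1 - colProj (D * X)) := by
    have := congrArg Matrix.transpose hM
    rwa [Matrix.transpose_mul, Matrix.transpose_mul, one_sub_colProj_transpose, hDt] at this
  have : psiMat tri θ σ = σ ^ 2 • (D * mMat tri θ * pinv Ξ * (mMat tri θ)ᵀ * D) := rfl
  rw [this, hM, Matrix.mul_assoc _ _ D, hMt]
  congr 1
  calc (1 - colProj (D * X)) * D * pinv Ξ * (D * (1 - colProj (D * X)))
      = (1 - colProj (D * X)) * (D * pinv Ξ * D) * (1 - colProj (D * X)) := by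
        simp only [Matrix.mul_assoc]
    _ = _ := by rw [hinv, Matrix.mul_one, one_sub_colProj_mul]

/-! ### The rank of the design -/

theorem linMat_mulVec (μ : Fin K → ℝ) (p : Pair K) : (linMat K *ᵥ μ) p = μ p.1.1 - μ p.1.2 := by
  simp [linMat, Matrix.mulVec, dotProduct, sub_mul, Finset.sum_sub_distrib]

theorem linMat_mulVec_one : linMat K *ᵥ 1 = 0 := by
  ext p
  simp [linMat_mulVec]

/-- The columns of `B` are orthogonal to the columns of `C`. -/
theorem cycMat_transpose_mul_linMat : (cycMat K)ᵀ * linMat K = 0 := by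
  have h : ∀ (μ : Fin K → ℝ) (x : Triad K), (cycMat K).col x ⬝ᵥ (linMat K *ᵥ μ) = 0 := by
    intro μ x
    obtain ⟨⟨i, j, k⟩, hij, hjk⟩ := x
    dsimp only at hij hjk
    -- As `i < j < k`, the reversed pairs index no row. Against `B μ` the three entries give `(μ i -
    -- μ j) + (μ j - μ k) - (μ i - μ k) = 0`.
    have hcol : (cycMat K).col ⟨⟨i, j, k⟩, hij, hjk⟩ =
        Pi.single (⟨(i, j), hij⟩ : Pair K) 1 + Pi.single (⟨(j, k), hjk⟩ : Pair K) 1 -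
          Pi.single (⟨(i, k), hij.trans hjk⟩ : Pair K) 1 := by
      ext ⟨⟨s, t⟩, hst⟩
      simp only [cycMat, Matrix.col_apply, Matrix.of_apply, Pi.add_apply, Pi.sub_apply,
        Pi.single_apply, Subtype.mk.injEq, Prod.mk.injEq]
      simp only [Fin.lt_def] at hst hij hjk
      simp only [Fin.ext_iff]
      split_ifs <;> first | omega | norm_num
    rw [hcol, sub_dotProduct, add_dotProduct]
    simp only [single_dotProduct, linMat_mulVec]
    ring
  ext x k
  have := h (Pi.single k 1) x
  rw [Matrix.mulVec_single_one] at this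
  exact this

theorem subCyc_transpose_mul_linMat (tri : Fin r → Triad K) : (subCyc tri)ᵀ * linMat K = 0 := by
  ext x k
  exact congrFun (congrFun (cycMat_transpose_mul_linMat (K := K)) (tri x)) k

theorem rank_diagonal_mul {m n : Type*} [Fintype m] [DecidableEq m] [Fintype n] {a : m → ℝ}
    (ha : ∀ i, a i ≠ 0) (X : Matrix m n ℝ) : (Matrix.diagonal a * X).rank = X.rank := by
  refine Matrix.rank_mul_eq_right_of_isUnit_det _ _ ?_
  rw [Matrix.det_diagonal, isUnit_iff_ne_zero, Finset.prod_ne_zero_iff]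
  exact fun p _ => ha p

/-- By orthogonality `B μ + C_s γ = 0` forces both terms to vanish: `γ = 0` by independence, and `μ`
is constant. The kernel is a line, which accounts for the `- 1`. -/
theorem rank_designMat (hK : 2 ≤ K) {tri : Fin r → Triad K}
    (hli : LinearIndependent ℝ (subCyc tri).col) : (designMat tri).rank = K + r - 1 := by
  have hker : LinearMap.ker (designMat tri).mulVecLin =
      Submodule.span ℝ {(Sum.elim 1 0 : Fin K ⊕ Fin r → ℝ)} := by
    ext c
    rw [LinearMap.mem_ker, Matrix.mulVecLin_apply, designMat_mulVec, Submodule.mem_span_singleton]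
    constructor
    · intro h
      set μ := c ∘ Sum.inl with hμ
      set γ := c ∘ Sum.inr with hγ
      have hC : subCyc tri *ᵥ γ = 0 := by
        have h1 : subCyc tri *ᵥ γ ⬝ᵥ (linMat K *ᵥ μ) = 0 := by
          rw [← Matrix.vecMul_transpose, ← Matrix.dotProduct_mulVec, Matrix.mulVec_mulVec,
            subCyc_transpose_mul_linMat, Matrix.zero_mulVec, dotProduct_zero]
        have h2 : subCyc tri *ᵥ γ ⬝ᵥ profile tri μ γ = 0 := by rw [h, dotProduct_zero]
        rw [profile, dotProduct_add, h1, zero_add] at h2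
        exact dotProduct_self_eq_zero.1 h2
      have hγ0 : γ = 0 := by
        apply (Matrix.mulVec_injective_iff.2 hli)
        rw [hC, Matrix.mulVec_zero]
      have hB : linMat K *ᵥ μ = 0 := by
        rw [profile, hC, add_zero] at h
        exact h
      refine ⟨μ ⟨0, by omega⟩, ?_⟩
      ext (i | j)
      · simp only [Pi.smul_apply, Sum.elim_inl, Pi.one_apply, smul_eq_mul, mul_one]
        by_cases hi : (⟨0, by omega⟩ : Fin K) = i
        · rw [hi]; rfl
        · have := congrFun hB ⟨(⟨0, by omega⟩, i), by
            rw [Fin.lt_def]; rw [Fin.ext_iff] at hi; dsimp only at hi ⊢; omega⟩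
          rw [linMat_mulVec] at this
          exact sub_eq_zero.1 this
      · have := congrFun hγ0 j
        simpa [hγ] using this.symm
    · rintro ⟨a, rfl⟩
      have e1 : (a • (Sum.elim 1 0 : Fin K ⊕ Fin r → ℝ)) ∘ Sum.inl = a • 1 := by
        ext; simp
      have e2 : (a • (Sum.elim 1 0 : Fin K ⊕ Fin r → ℝ)) ∘ Sum.inr = 0 := by
        ext; simp
      rw [profile, e1, e2, Matrix.mulVec_smul, linMat_mulVec_one, Matrix.mulVec_zero]
      simp
  have h := LinearMap.finrank_range_add_finrank_ker (designMat tri).mulVecLin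
  have hne : (Sum.elim 1 0 : Fin K ⊕ Fin r → ℝ) ≠ 0 := fun h => by
    have := congrFun h (Sum.inl ⟨0, by omega⟩)
    simp at this
  rw [hker, finrank_span_singleton hne, Module.finrank_fintype_fun_eq_card, Fintype.card_sum,
    Fintype.card_fin, Fintype.card_fin] at h
  rw [Matrix.rank]
  omega

theorem card_pair (K : ℕ) : Fintype.card (Pair K) = K.choose 2 := by
  have h : Fintype.card (Pair K) = ∑ j : Fin K, (Finset.Iio j).card := by
    rw [Fintype.card_subtype, ← Finset.card_sigma]
    refine Finset.card_bij (fun p _ => ⟨p.2, p.1⟩) (by simp) ?_ ?_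
    · rintro ⟨a, b⟩ _ ⟨c, d⟩ _ h
      simp_all
    · rintro ⟨a, b⟩ h
      exact ⟨(b, a), by simpa using h, rfl⟩
  simp_rw [h, Fin.card_Iio]
  rw [Fin.sum_univ_eq_sum_range (fun i => i) K, Finset.sum_range_id, Nat.choose_two_right]

/-! ### Normal equations -/

theorem sumSq_add_smul (N : Pair K → ℕ) (Y : Pair K → ℕ → ℝ) (v w : Pair K → ℝ) (s : ℝ) :
    sumSq N Y (v + s • w) = sumSq N Y v -
      2 * s * (∑ p, w p * ((N p : ℝ) * (avg N Y p - v p))) + s ^ 2 * ∑ p, (N p : ℝ) * w p ^ 2 := by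
  simp only [sumSq, Finset.mul_sum, ← Finset.sum_sub_distrib, ← Finset.sum_add_distrib]
  refine Finset.sum_congr rfl fun p _ => ?_
  have h : (N p : ℝ) * (avg N Y p - v p) = ∑ k ∈ Finset.range (N p), (Y p k - v p) := by
    rw [Finset.sum_sub_distrib, Finset.sum_const, Finset.card_range, nsmul_eq_mul, avg, mul_sub]
    congr 1
    -- With no comparisons both sides are zero, whatever value the average takes.
    by_cases hN : N p = 0
    · simp [hN]
    · field_simp
  rw [h]
  have h2 : ∀ k, (Y p k - (v + s • w) p) ^ 2 =
      (Y p k - v p) ^ 2 - 2 * s * w p * (Y p k - v p) + s ^ 2 * w p ^ 2 := by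
    intro k
    simp only [Pi.add_apply, Pi.smul_apply, smul_eq_mul]
    ring
  simp only [h2, Finset.sum_add_distrib, Finset.sum_sub_distrib, ← Finset.mul_sum,
    Finset.sum_const, Finset.card_range, nsmul_eq_mul]
  ring

theorem eq_zero_of_forall_quadratic_nonneg {a b : ℝ} (h : ∀ s : ℝ, 0 ≤ s ^ 2 * b - 2 * s * a) :
    a = 0 := by
  have hd := discrim_le_zero (a := b) (b := -2 * a) (c := 0) fun s => by
    have := h s
    nlinarith
  rw [discrim] at hd
  nlinarith [sq_nonneg a]

/-- The criterion is quadratic along a line through the minimizer, so its linear coefficient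
vanishes. The constraint `∑ μ i = 0` excludes no direction of profiles, since `B` kills constants.
-/
theorem IsLSE.normal_eq {tri : Fin r → Triad K} {N : Pair K → ℕ} {Y : Pair K → ℕ → ℝ}
    {μ : Fin K → ℝ} {γ : Fin r → ℝ} (h : IsLSE tri N Y μ γ) (μ' : Fin K → ℝ) (γ' : Fin r → ℝ) :
    ∑ p, profile tri μ' γ' p * ((N p : ℝ) * (avg N Y p - profile tri μ γ p)) = 0 := by
  by_cases hK : K = 0
  · subst hK
    exact Finset.sum_eq_zero fun p _ => p.1.1.elim0
  have hK' : (K : ℝ) ≠ 0 := Nat.cast_ne_zero.2 hK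
  refine eq_zero_of_forall_quadratic_nonneg
    (b := ∑ p, (N p : ℝ) * profile tri μ' γ' p ^ 2) fun s => ?_
  -- Subtracting the mean of `μ'` keeps the perturbed point feasible without changing its profile.
  set a : ℝ := (∑ i, μ' i) / K with ha
  have h1 := h.le (μ + s • (μ' - a • 1)) (γ + s • γ') (by
    simp only [Pi.add_apply, Pi.smul_apply, Pi.sub_apply, Pi.one_apply, smul_eq_mul, mul_one,
      Finset.sum_add_distrib, ← Finset.mul_sum, Finset.sum_sub_distrib, h.sum_eq_zero,
      Finset.sum_const, Finset.card_univ, Fintype.card_fin, nsmul_eq_mul]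
    rw [ha]
    field_simp
    ring)
  have h2 : profile tri (μ + s • (μ' - a • 1)) (γ + s • γ') =
      profile tri μ γ + s • profile tri μ' γ' := by
    simp only [profile, Matrix.mulVec_add, Matrix.mulVec_smul, Matrix.mulVec_sub, linMat_mulVec_one,
      smul_zero, sub_zero, smul_add]
    abel
  rw [h2, sumSq_add_smul] at h1
  linarith

theorem IsLSE.transpose_mulVec_residual {tri : Fin r → Triad K} {N : Pair K → ℕ}
    {Y : Pair K → ℕ → ℝ} {μ : Fin K → ℝ} {γ : Fin r → ℝ} (h : IsLSE tri N Y μ γ) :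
    (Matrix.diagonal (fun p => √(N p : ℝ)) * designMat tri)ᵀ *ᵥ
      residual N Y (profile tri μ γ) = 0 := by
  refine dotProduct_eq_zero _ fun c => ?_
  rw [Matrix.mulVec_transpose, ← Matrix.dotProduct_mulVec, ← Matrix.mulVec_mulVec,
    designMat_mulVec]
  have := h.normal_eq (c ∘ Sum.inl) (c ∘ Sum.inr)
  rw [← this]
  refine Finset.sum_congr rfl fun p _ => ?_
  rw [residual, Matrix.mulVec_diagonal, Matrix.mulVec_diagonal]
  have hs := Real.mul_self_sqrt (Nat.cast_nonneg (α := ℝ) (N p))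
  simp only [Pi.sub_apply]
  linear_combination (avg N Y p - profile tri μ γ p) *
    profile tri (c ∘ Sum.inl) (c ∘ Sum.inr) p * hs

/-- Under the model, the lack-of-fit statistic is a quadratic form in the scaled errors. -/
theorem IsLSE.lackOfFit_eq {tri : Fin r → Triad K} {N : Pair K → ℕ}
    {Y e : Pair K → ℕ → ℝ} {μ : Fin K → ℝ} {γ : Fin r → ℝ} (h : IsLSE tri N Y μ γ)
    {ν : Pair K → ℝ} (hν : ν ∈ modelSpace tri) (hY : ∀ p k, Y p k = ν p + e p k) :
    lackOfFit N Y (profile tri μ γ) =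
      (fun p => (√(N p : ℝ))⁻¹ * ∑ k ∈ Finset.range (N p), e p k) ⬝ᵥ
        (1 - colProj (Matrix.diagonal (fun p => √(N p : ℝ)) * designMat tri)) *ᵥ
          fun p => (√(N p : ℝ))⁻¹ * ∑ k ∈ Finset.range (N p), e p k := by
  obtain ⟨c, hc⟩ := exists_designMat_mulVec_eq hν
  -- With `ν = X c`, the residual is `W - D^{1/2} X (ĉ - c)`, where `ĉ` is the estimate.
  refine dotProduct_self_of_orthogonal (c := Sum.elim μ γ - c) ?_ h.transpose_mulVec_residual
  rw [← Matrix.mulVec_mulVec, Matrix.mulVec_sub, hc, designMat_mulVec, Sum.elim_comp_inl,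
    Sum.elim_comp_inr, residual]
  ext p
  simp only [Matrix.mulVec_diagonal, Pi.sub_apply, avg, hY]
  by_cases hN : N p = 0
  · simp [hN]
  · have hN' : (0 : ℝ) < N p := Nat.cast_pos.2 (Nat.pos_of_ne_zero hN)
    have hs := Real.mul_self_sqrt hN'.le
    have hs0 := (Real.sqrt_pos.2 hN').ne'
    rw [Finset.sum_add_distrib, Finset.sum_const, Finset.card_range, nsmul_eq_mul]
    field_simp
    rw [sq, hs]
    field_simp
    ring

/-! ### Passage to the limit -/

/-- If the law of `W` tends to the law of `Z` and the deterministic matrices `Q` tend to `Q₀`, then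
`Wᵀ Q W` tends in distribution to `Zᵀ Q₀ Z`. -/
theorem tendstoInDistribution_quadraticForm {Ω Ω' n : Type*} [MeasurableSpace Ω]
    [MeasurableSpace Ω'] {P : Measure Ω} [IsProbabilityMeasure P] {P' : Measure Ω'}
    [IsProbabilityMeasure P'] [Fintype n] {W : ℕ → Ω → EuclideanSpace ℝ n}
    {Z : Ω' → EuclideanSpace ℝ n} (hW : TendstoInDistribution W atTop Z (fun _ => P) P')
    {Q : ℕ → Matrix n n ℝ} {Q₀ : Matrix n n ℝ} (hQ : Tendsto Q atTop (𝓝 Q₀)) :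
    TendstoInDistribution (fun m ω => (W m ω).ofLp ⬝ᵥ Q m *ᵥ (W m ω).ofLp) atTop
      (fun ω => (Z ω).ofLp ⬝ᵥ Q₀ *ᵥ (Z ω).ofLp) (fun _ => P) P' := by
  have hg : Continuous fun p : EuclideanSpace ℝ n × (n → n → ℝ) =>
      p.1.ofLp ⬝ᵥ Matrix.of p.2 *ᵥ p.1.ofLp := by
    simp only [dotProduct, Matrix.mulVec, Matrix.of_apply]
    fun_prop
  -- Slutsky's theorem, with the deterministic `Q m` viewed as constant random variables.
  exact hW.continuous_comp_prodMk_of_tendstoInMeasure_const (g := fun p =>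
      p.1.ofLp ⬝ᵥ Matrix.of p.2 *ᵥ p.1.ofLp) hg (Y := fun m _ => (Q m : n → n → ℝ))
    (c := (Q₀ : n → n → ℝ))
    (tendstoInMeasure_of_tendsto_ae (fun m => aestronglyMeasurable_const)
      (Eventually.of_forall fun _ => hQ)) (fun m => aemeasurable_const)

theorem tendstoInDistribution_of_map_eq {Ω Ω₁ Ω₂ E : Type*} [MeasurableSpace Ω]
    [MeasurableSpace Ω₁] [MeasurableSpace Ω₂] [MeasurableSpace E] [TopologicalSpace E]
    [OpensMeasurableSpace E] {P : Measure Ω}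
    [IsProbabilityMeasure P] {P₁ : Measure Ω₁} [IsProbabilityMeasure P₁]
    {P₂ : Measure Ω₂} [IsProbabilityMeasure P₂] {X : ℕ → Ω → E} {Z₁ : Ω₁ → E} {Z₂ : Ω₂ → E}
    (h : TendstoInDistribution X atTop Z₁ (fun _ => P) P₁) (hZ₂ : AEMeasurable Z₂ P₂)
    (hmap : P₂.map Z₂ = P₁.map Z₁) : TendstoInDistribution X atTop Z₂ (fun _ => P) P₂ where
  forall_aemeasurable := h.forall_aemeasurable
  aemeasurable_limit := hZ₂
  tendsto := by
    simp only [hmap]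
    exact h.tendsto

/-- The entries `√(N m p)` diverge, but a projection does not change when its matrix is rescaled.
Dividing by `√n` gives entries tending to `√(θ p) > 0`, where the projection is continuous. -/
theorem tendsto_colProj_design {K r : ℕ} (tri : Fin r → Triad K) {N : ℕ → Pair K → ℕ}
    {θ : Pair K → ℝ} (hN : ∀ p, Tendsto (fun m => N m p) atTop atTop)
    (hθ : ∀ p, Tendsto (fun m => (N m p : ℝ) / ((∑ q, N m q : ℕ) : ℝ)) atTop (𝓝 (θ p)))
    (hθpos : ∀ p, 0 < θ p) :
    Tendsto (fun m => colProj (Matrix.diagonal (fun p => √(N m p : ℝ)) * designMat tri)) atTop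
      (𝓝 (colProj (Matrix.diagonal (fun p => √(θ p)) * designMat tri))) := by
  have h1 := tendsto_colProj_diagonal_mul (designMat tri)
    (tendsto_pi_nhds.2 fun p => (hθ p).sqrt) fun p => (Real.sqrt_pos.2 (hθpos p)).ne'
  refine h1.congr' ?_
  have hpos : ∀ᶠ m in atTop, ∀ p, 0 < N m p :=
    eventually_all.2 fun p => (hN p).eventually_gt_atTop 0
  filter_upwards [hpos] with m hm
  rcases isEmpty_or_nonempty (Pair K) with hK | ⟨⟨p⟩⟩
  · ext p
    exact hK.elim p
  set n : ℝ := ((∑ q, N m q : ℕ) : ℝ) with hn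
  have hn0 : 0 < n := by
    rw [hn, Nat.cast_pos]
    exact Finset.sum_pos (fun q _ => hm q) ⟨p, Finset.mem_univ p⟩
  have hs : √n ≠ 0 := (Real.sqrt_pos.2 hn0).ne'
  have hD : (Matrix.diagonal fun p => √(N m p / n)) =
      (√n)⁻¹ • Matrix.diagonal fun p => √(N m p : ℝ) := by
    rw [← Matrix.diagonal_smul]
    congr 1
    ext q
    rw [Pi.smul_apply, Real.sqrt_div (Nat.cast_nonneg _), smul_eq_mul, div_eq_inv_mul]
  refine colProj_congr (H := (√n)⁻¹ • 1) (F := √n • 1) ?_ ?_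
  · rw [hD, Matrix.smul_mul, Matrix.mul_smul, Matrix.mul_one]
  · rw [hD, Matrix.smul_mul, Matrix.mul_smul, Matrix.mul_one, smul_inv_smul₀ hs]

end PairedComparison

/-! ### The limit law and its number of weights -/

theorem mainTheorem5
    {K r : ℕ} (hK : 2 ≤ K) (tri : Fin r → Triad K)
    {Ω : Type*} [MeasurableSpace Ω] (P : Measure Ω) [IsProbabilityMeasure P]
    -- the model `Y_{ijk} = ν_{ij} + ε_{ijk}` with i.i.d. errors
    (ν : Pair K → ℝ) (ε Y : Pair K → ℕ → Ω → ℝ) (σ : ℝ) (hσ : 0 < σ)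
    (hY : ∀ p k ω, Y p k ω = ν p + ε p k ω)
    (hindep : iIndepFun (fun a : Pair K × ℕ => ε a.1 a.2) P)
    (hident : ∀ p k q l, IdentDistrib (ε p k) (ε q l) P P)
    (hL2 : ∀ p k, MemLp (ε p k) 2 P)
    (hmean : ∀ p k, ∫ ω, ε p k ω ∂P = 0)
    (hvar : ∀ p k, variance (ε p k) P = σ ^ 2)
    -- the null hypothesis
    (hν : ν ∈ modelSpace tri)
    -- the numbers of comparisons at stage `m`, and their limiting proportions
    (N : ℕ → Pair K → ℕ) (θ : Pair K → ℝ)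
    (hN : ∀ p, Tendsto (fun m => N m p) atTop atTop)
    (hθ : ∀ p, Tendsto (fun m => (N m p : ℝ) / ((∑ q, N m q : ℕ) : ℝ)) atTop (𝓝 (θ p)))
    (hθpos : ∀ p, 0 < θ p)
    -- the least squares estimators
    (muHat : ℕ → Ω → Fin K → ℝ) (gammaHat : ℕ → Ω → Fin r → ℝ)
    (hLSE : ∀ m ω, IsLSE tri (N m) (fun p k => Y p k ω) (muHat m ω) (gammaHat m ω))
    -- the nonzero eigenvalues of `Ψ_S`, listed with their multiplicities
    {t : ℕ} (lam : Fin t → ℝ)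
    (hlam : Multiset.map lam Finset.univ.val =
      (psiMat tri θ σ).charpoly.roots.filter (fun x => x ≠ 0))
    -- independent standard normal variables
    {Ω' : Type*} [MeasurableSpace Ω'] (P' : Measure Ω') [IsProbabilityMeasure P']
    (Z : Fin t → Ω' → ℝ) (hZindep : iIndepFun Z P')
    (hZlaw : ∀ i, HasLaw (Z i) (gaussianReal 0 1) P') :
    TendstoInDistribution
      (fun m ω => lackOfFit (N m) (fun p k => Y p k ω)
        (profile tri (muHat m ω) (gammaHat m ω)))
      atTop (fun ω' => ∑ i, lam i * Z i ω' ^ 2) (fun _ => P) P' ∧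
    t = (psiMat tri θ σ).rank ∧
    (LinearIndependent ℝ (subCyc tri).col → t + (K + r - 1) = K.choose 2) := by
  have hψ := psiMat_eq tri hθpos σ
  set A := Matrix.diagonal (fun p => √(θ p)) * designMat tri with hA
  have hψH : (psiMat tri θ σ).IsHermitian := by
    rw [hψ, Matrix.IsHermitian, Matrix.conjTranspose_eq_transpose_of_trivial,
      Matrix.transpose_smul, one_sub_colProj_transpose]
  obtain ⟨e, -⟩ := exists_equiv_nonzero_eigenvalues hψH hlam
  have ht : t = (psiMat tri θ σ).rank := by
    rw [hψH.rank_eq_card_non_zero_eigs, ← Fintype.card_congr e, Fintype.card_fin]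
  refine ⟨?_, ht, fun hli => ?_⟩
  · have hW := tendstoInDistribution_toLp_sum hindep (fun p k l => hident p k p l) hL2 hmean hvar hN
    have hlim := tendstoInDistribution_quadraticForm hW
      (tendsto_const_nhds.sub (tendsto_colProj_design tri hN hθ hθpos) :
        Tendsto (fun m => 1 - colProj (Matrix.diagonal (fun p => √(N m p : ℝ)) * designMat tri))
          atTop (𝓝 (1 - colProj A)))
    have hR : ∀ m ω, lackOfFit (N m) (fun p k => Y p k ω)
        (profile tri (muHat m ω) (gammaHat m ω)) = _ := fun m ω =>
      (hLSE m ω).lackOfFit_eq (e := fun p k => ε p k ω) hν fun p k => hY p k ω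
    simp_rw [hR]
    have hZ : ∀ i, AEMeasurable (Z i) P' := fun i => (hZlaw i).aemeasurable
    refine tendstoInDistribution_of_map_eq hlim (by fun_prop) ?_
    -- The factor `σ` on each side of the limiting form combines into the `σ²` of `Ψ_S`.
    rw [map_sum_sq_eq_map_quadraticForm hψH hlam hZindep hZlaw, hψ]
    congr 1
    ext x
    simp only [WithLp.ofLp_smul, Matrix.smul_mulVec, Matrix.mulVec_smul, dotProduct_smul,
      smul_dotProduct, smul_eq_mul]
    ring
  · have h1 := rank_one_sub_colProj A
    rw [hA, rank_diagonal_mul (fun p => (Real.sqrt_pos.2 (hθpos p)).ne'), rank_designMat hK hli,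
      ← hA, card_pair] at h1
    rw [ht, hψ, Matrix.rank_smul_of_mem_nonZeroDivisors _ (mem_nonZeroDivisors_of_ne_zero (pow_ne_zero 2 hσ.ne'))]
    exact h1
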